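/- **Conventions.** A DG algebra is a graded commutative, associative, unital differential graded algebra over $\mathbb{Z}$, and complexes are indexed homologically (the differential has degree $-1$). For a complex $X$ put $\sup H(X)=\sup\{i\in\mathbb{Z}\mid H_i(X)\neq 0\}$, $\inf H(X)=\inf\{i\in\mathbb{Z}\mid H_i(X)\neq 0\}$ in $\mathbb{Z}\cup\{\pm\infty\}$ (with $\sup\varnothing=-\infty$, $\inf\varnothing=+\infty$) and $\operatorname{amp} H(X)=\sup H(X)-\inf H(X)$ (with $-\infty-\infty=-\infty$); $X$ is homologically bounded if $\operatorname{amp} H(X)<\infty$. A DG algebra $A$ is positively graded if $A_i=0$ for all $i<0$. A DG $A$-module $X$ is semifree if $X_i=0$ for all $i\ll 0$ and $X$ has a semibasis, i.e., a set of homogeneous elements which is a basis of the underlying module $X^\natural$ over the underlying algebra $A^\natural$. For DG $A$-modules $L$ and $Y$, $L\otimes^{\mathbf L}_A Y$ denotes $F\otimes_A Y$, where $F\xrightarrow{\simeq}L$ is any semifree resolution, i.e., a quasiisomorphism of DG $A$-modules with $F$ semifree. **Proposition 3.4.** Let $A$ be a positively graded DG algebra with $\operatorname{amp} H(A)=s$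 for some $s\in\mathbb{Z}$ (so $H(A)$ is non-zero and bounded). Let $L$ be a non-zero semifree DG $A$-module with a semibasis concentrated in degrees $n,n+1,\ldots,n+m$, where $n,m\in\mathbb{Z}$ and $m\geq 0$, and let $Y$ be a homologically bounded DG $A$-module. Then $$\inf H(L\otimes^{\mathbf L}_A Y)\;\geq\;\inf H(Y)+n,\qquad \sup H(L\otimes^{\mathbf L}_A Y)\;\leq\;\sup H(Y)+n+m,$$ and consequently $$\operatorname{amp} H(L\otimes^{\mathbf L}_A Y)\;\leq\;\operatorname{amp} H(Y)+m.$$ -/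

import Mathlib

open scoped TensorProduct DirectSum

universe u v w x

/-- The sign `(-1) ^ i`, for `i : ℤ`. -/
def dgSign (i : ℤ) : ℤ := (i.negOnePow : ℤ)

theorem dgSign_add (i j : ℤ) : dgSign (i + j) = dgSign i * dgSign j := by
  simp [dgSign, Int.negOnePow_add]

theorem dgSign_mul_self (i : ℤ) : dgSign i * dgSign i = 1 := by
  simp [dgSign, ← Units.val_mul]

theorem dgSign_sub_one (i : ℤ) : dgSign (i - 1) = -dgSign i := by
  simp [dgSign, Int.negOnePow_sub]

/-- A complex of abelian groups, indexed homologically, presented on the total group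
`M = ⨁ i, M_i`: a `ℤ`-grading by subgroups and a differential of degree `-1`. -/
structure DGComplex (M : Type u) [AddCommGroup M] where
  /-- the component of degree `i` -/
  gr : ℤ → AddSubgroup M
  isInternal : DirectSum.IsInternal gr
  /-- the differential -/
  d : M →+ M
  d_mem : ∀ {i : ℤ} {z : M}, z ∈ gr i → d z ∈ gr (i - 1)
  d_d : ∀ z : M, d (d z) = 0

namespace DGComplex

variable {M : Type u} [AddCommGroup M] (C : DGComplex M)

/-- The group of cycles of degree `i`. -/
def cycles (i : ℤ) : AddSubgroup M := C.gr i ⊓ C.d.ker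

/-- The group of boundaries of degree `i`. -/
def boundaries (i : ℤ) : AddSubgroup M := (C.gr (i + 1)).map C.d

/-- The homology group `H_i`, cycles modulo boundaries. -/
abbrev Homology (i : ℤ) : Type u :=
  C.cycles i ⧸ (C.boundaries i).addSubgroupOf (C.cycles i)

/-- `sup H(C) = sup {i | H_i(C) ≠ 0}`, equal to `-∞` when `H(C) = 0`. -/
noncomputable def supH : EReal :=
  sSup ((fun i : ℤ => ((i : ℝ) : EReal)) '' {i : ℤ | Nontrivial (C.Homology i)})

/-- `inf H(C) = inf {i | H_i(C) ≠ 0}`, equal to `+∞` when `H(C) = 0`. -/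
noncomputable def infH : EReal :=
  sInf ((fun i : ℤ => ((i : ℝ) : EReal)) '' {i : ℤ | Nontrivial (C.Homology i)})

/-- `amp H(C) = sup H(C) - inf H(C)`, equal to `-∞` when `H(C) = 0`. -/
noncomputable def ampH : EReal := C.supH - C.infH

/-- `C` is homologically bounded if `amp H(C) < ∞`. -/
def HomologicallyBounded : Prop := C.ampH < ⊤

/-- `inf C > -∞`: the components of sufficiently negative degree vanish. -/
def BoundedBelow : Prop := ∃ N : ℤ, ∀ i < N, C.gr i = ⊥

/-- The identification of the total group with the direct sum of the components. -/
noncomputable def decomp : M ≃+ ⨁ i, C.gr i :=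
  (AddEquiv.ofBijective (DirectSum.coeAddMonoidHom C.gr) C.isInternal).symm

theorem decomp_of_mem {i : ℤ} {z : M} (hz : z ∈ C.gr i) :
    C.decomp z = DirectSum.of (fun i => C.gr i) i ⟨z, hz⟩ := by
  rw [decomp, AddEquiv.symm_apply_eq]
  exact (DirectSum.coeAddMonoidHom_of C.gr i ⟨z, hz⟩).symm

theorem induction_on {P : M → Prop} (z : M) (zero : P 0)
    (hom : ∀ (i : ℤ) (z : M), z ∈ C.gr i → P z)
    (add : ∀ z z' : M, P z → P z' → P (z + z')) : P z := by
  obtain ⟨t, rfl⟩ := C.isInternal.2 z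
  induction t using DirectSum.induction_on with
  | zero => simpa using zero
  | of i t => simpa using hom i _ t.2
  | add s t hs ht => rw [map_add]; exact add _ _ hs ht

/-- The additive map which multiplies homogeneous elements of degree `i` by `(-1) ^ i`. -/
noncomputable def twist : M →+ M :=
  (DirectSum.toAddMonoid fun i => dgSign i • (C.gr i).subtype).comp C.decomp.toAddMonoidHom

theorem twist_of_mem {i : ℤ} {z : M} (hz : z ∈ C.gr i) : C.twist z = dgSign i • z := by
  simp [twist, C.decomp_of_mem hz]

end DGComplex

/-- A (graded commutative) differential graded algebra over `ℤ`; the ring `A` is the underlying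
algebra `⨁ i, A_i`. -/
structure DGAlgebra (A : Type u) [Ring A] extends DGComplex A where
  one_mem : (1 : A) ∈ gr 0
  mul_mem : ∀ {i j : ℤ} {a b : A}, a ∈ gr i → b ∈ gr j → a * b ∈ gr (i + j)
  leibniz : ∀ {i : ℤ} {a : A} (b : A), a ∈ gr i → d (a * b) = d a * b + dgSign i • (a * d b)
  graded_comm : ∀ {i j : ℤ} {a b : A}, a ∈ gr i → b ∈ gr j → a * b = dgSign (i * j) • (b * a)

/-- `A_i = 0` for all `i < 0`. -/
def DGAlgebra.PositivelyGraded {A : Type u} [Ring A] (𝒜 : DGAlgebra A) : Prop :=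
  ∀ i < 0, 𝒜.gr i = ⊥

/-- A (left) differential graded module over `𝒜`; the `A`-module `M` is the underlying module
`⨁ i, M_i`. -/
structure DGModule {A : Type u} [Ring A] (𝒜 : DGAlgebra A) (M : Type v) [AddCommGroup M]
    [Module A M] extends DGComplex M where
  smul_mem : ∀ {i j : ℤ} {a : A} {z : M}, a ∈ 𝒜.gr i → z ∈ gr j → a • z ∈ gr (i + j)
  leibniz : ∀ {i : ℤ} {a : A} (z : M), a ∈ 𝒜.gr i →
    d (a • z) = 𝒜.d a • z + dgSign i • (a • d z)

/-- A morphism of DG modules: an `A`-linear chain map of degree `0`. -/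
structure DGHom {A : Type u} [Ring A] {𝒜 : DGAlgebra A}
    {M : Type v} [AddCommGroup M] [Module A M] (ℳ : DGModule 𝒜 M)
    {N : Type w} [AddCommGroup N] [Module A N] (𝒩 : DGModule 𝒜 N) where
  toFun : M →ₗ[A] N
  map_mem : ∀ {i : ℤ} {z : M}, z ∈ ℳ.gr i → toFun z ∈ 𝒩.gr i
  map_d : ∀ z : M, toFun (ℳ.d z) = 𝒩.d (toFun z)

namespace DGHom

variable {A : Type u} [Ring A] {𝒜 : DGAlgebra A}
  {M : Type v} [AddCommGroup M] [Module A M] {ℳ : DGModule 𝒜 M}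
  {N : Type w} [AddCommGroup N] [Module A N] {𝒩 : DGModule 𝒜 N} (f : DGHom ℳ 𝒩)

/-- The map induced on cycles. -/
def cyclesMap (i : ℤ) : ℳ.cycles i →+ 𝒩.cycles i :=
  (f.toFun.toAddMonoidHom.comp (ℳ.cycles i).subtype).codRestrict (𝒩.cycles i) fun z =>
    ⟨f.map_mem z.2.1, by
      have h : ℳ.d z = 0 := z.2.2
      change 𝒩.d (f.toFun z) = 0
      rw [← f.map_d, h, map_zero]⟩

/-- The map induced on homology. -/
def homologyMap (i : ℤ) : ℳ.Homology i →+ 𝒩.Homology i :=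
  QuotientAddGroup.map _ _ (f.cyclesMap i) (by
    rintro z ⟨b, hb, hbz⟩
    refine ⟨f.toFun b, f.map_mem hb, ?_⟩
    change ℳ.d b = (z : M) at hbz
    change 𝒩.d (f.toFun b) = f.toFun z
    rw [← f.map_d, hbz])

/-- `f` is a quasiisomorphism: it induces isomorphisms on homology. -/
def IsQuasiIso : Prop := ∀ i : ℤ, Function.Bijective (f.homologyMap i)

end DGHom

namespace DGModule

variable {A : Type u} [Ring A] {𝒜 : DGAlgebra A}

section Semifree

variable {M : Type v} [AddCommGroup M] [Module A M] (ℳ : DGModule 𝒜 M)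

/-- A semibasis: a set of homogeneous elements which is a basis of the underlying module over the
underlying algebra. -/
structure IsSemibasis (B : Set M) : Prop where
  homogeneous : ∀ b ∈ B, ∃ i : ℤ, b ∈ ℳ.gr i
  linearIndependent : LinearIndependent A (Subtype.val : B → M)
  span_eq_top : Submodule.span A B = ⊤

/-- A DG module is semifree if it is bounded below and free, as a graded module, over the
underlying algebra. -/
def IsSemifree : Prop := ℳ.BoundedBelow ∧ ∃ B : Set M, ℳ.IsSemibasis B

end Semifree

/-- A semifree resolution of `ℳ`: a quasiisomorphism to `ℳ` from a semifree DG module. -/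
structure SemifreeResolution {M : Type v} [AddCommGroup M] [Module A M] (ℳ : DGModule 𝒜 M) where
  F : Type w
  [addCommGroup : AddCommGroup F]
  [module : Module A F]
  dgModule : DGModule 𝒜 F
  isSemifree : dgModule.IsSemifree
  hom : DGHom dgModule ℳ
  isQuasiIso : hom.IsQuasiIso

attribute [instance] SemifreeResolution.addCommGroup SemifreeResolution.module

section Tensor

variable {M : Type v} [AddCommGroup M] [Module A M] (ℳ : DGModule 𝒜 M)
  {N : Type w} [AddCommGroup N] [Module A N] (𝒩 : DGModule 𝒜 N)

/-- The relations `xa ⊗ y = x ⊗ ay` where the right action of `𝒜` on `ℳ` is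
`xa = (-1) ^ (|a| |x|) ax`. -/
def tensorRel (N : Type w) [AddCommGroup N] [Module A N] : Submodule ℤ (M ⊗[ℤ] N) :=
  Submodule.span ℤ {t | ∃ (i j : ℤ) (a : A) (z : M) (y : N), a ∈ 𝒜.gr i ∧ z ∈ ℳ.gr j ∧
    t = (dgSign (i * j) • (a • z)) ⊗ₜ[ℤ] y - z ⊗ₜ[ℤ] (a • y)}

/-- The underlying abelian group of the tensor product of DG modules over `𝒜`. -/
abbrev TensorObj (N : Type w) [AddCommGroup N] [Module A N] : Type (max v w) :=
  (M ⊗[ℤ] N) ⧸ ℳ.tensorRel N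

/-- The element `z ⊗ y`. -/
def tmul {N : Type w} [AddCommGroup N] [Module A N] (z : M) (y : N) : ℳ.TensorObj N :=
  (ℳ.tensorRel N).mkQ (z ⊗ₜ[ℤ] y)

/-- The component of degree `k` is generated by the elements `z ⊗ y` with `z` and `y` homogeneous
and `|z| + |y| = k`. -/
def tensorGr (k : ℤ) : AddSubgroup (ℳ.TensorObj N) :=
  AddSubgroup.closure {t | ∃ (i j : ℤ) (z : M) (y : N), z ∈ ℳ.gr i ∧ y ∈ 𝒩.gr j ∧ i + j = k ∧
    t = ℳ.tmul z y}

/-- `z ⊗ y ↦ dz ⊗ y + (-1) ^ |z| z ⊗ dy` on the tensor product over `ℤ`. -/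
noncomputable def tensorPreD : M ⊗[ℤ] N →ₗ[ℤ] M ⊗[ℤ] N :=
  TensorProduct.map ℳ.d.toIntLinearMap LinearMap.id +
    TensorProduct.map ℳ.twist.toIntLinearMap 𝒩.d.toIntLinearMap

theorem tensorPreD_tmul {j : ℤ} {z : M} (hz : z ∈ ℳ.gr j) (y : N) :
    ℳ.tensorPreD 𝒩 (z ⊗ₜ y) = ℳ.d z ⊗ₜ y + dgSign j • (z ⊗ₜ[ℤ] 𝒩.d y) := by
  change ℳ.d z ⊗ₜ[ℤ] y + ℳ.twist z ⊗ₜ[ℤ] 𝒩.d y = _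
  rw [ℳ.twist_of_mem hz, TensorProduct.smul_tmul']

theorem rel_mem {i j : ℤ} {a : A} {z : M} (ha : a ∈ 𝒜.gr i) (hz : z ∈ ℳ.gr j) (y : N) :
    dgSign (i * j) • ((a • z) ⊗ₜ[ℤ] y) - z ⊗ₜ[ℤ] (a • y) ∈ ℳ.tensorRel N := by
  refine Submodule.subset_span ⟨i, j, a, z, y, ha, hz, ?_⟩
  rw [TensorProduct.smul_tmul']

theorem tensorPreD_mem : ℳ.tensorRel N ≤ (ℳ.tensorRel N).comap (ℳ.tensorPreD 𝒩) := by
  refine Submodule.span_le.2 ?_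
  rintro _ ⟨i, j, a, z, y, ha, hz, rfl⟩
  have h1 := ℳ.rel_mem (𝒜.d_mem ha) hz y
  have h2 := ℳ.rel_mem ha (ℳ.d_mem hz) y
  have h3 := ℳ.rel_mem ha hz (𝒩.d y)
  have e1 : dgSign ((i - 1) * j) = dgSign (i * j) * dgSign j := by
    have := dgSign_add ((i - 1) * j) j
    rw [show (i - 1) * j + j = i * j by ring] at this
    rw [this, mul_assoc, dgSign_mul_self, mul_one]
  have e2 : dgSign (i * (j - 1)) = dgSign (i * j) * dgSign i := by
    have := dgSign_add (i * (j - 1)) i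
    rw [show i * (j - 1) + i = i * j by ring] at this
    rw [this, mul_assoc, dgSign_mul_self, mul_one]
  have key := Submodule.add_mem _ (Submodule.add_mem _
    (Submodule.smul_mem _ (dgSign j) h1) h2) (Submodule.smul_mem _ (dgSign (i + j)) h3)
  change ℳ.tensorPreD 𝒩 _ ∈ ℳ.tensorRel N
  convert key using 1
  rw [map_sub, ← TensorProduct.smul_tmul', map_smul, ℳ.tensorPreD_tmul 𝒩 (ℳ.smul_mem ha hz),
    ℳ.tensorPreD_tmul 𝒩 hz, ℳ.leibniz z ha, 𝒩.leibniz y ha, e1, e2, dgSign_add]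
  simp only [TensorProduct.add_tmul, TensorProduct.tmul_add, ← TensorProduct.smul_tmul',
    TensorProduct.tmul_smul, smul_sub, smul_add, smul_smul]
  have hj := dgSign_mul_self j
  rw [show dgSign j * (dgSign (i * j) * dgSign j) = dgSign (i * j) by
    linear_combination dgSign (i * j) * hj,
    show dgSign i * dgSign j * dgSign (i * j) = dgSign (i * j) * (dgSign i * dgSign j) by ring,
    mul_comm (dgSign j) (dgSign i)]
  abel

/-- The differential `d(z ⊗ y) = dz ⊗ y + (-1) ^ |z| z ⊗ dy` of the tensor product. -/
noncomputable def tensorD : ℳ.TensorObj N →ₗ[ℤ] ℳ.TensorObj N :=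
  (ℳ.tensorRel N).mapQ (ℳ.tensorRel N) (ℳ.tensorPreD 𝒩) (ℳ.tensorPreD_mem 𝒩)

theorem tensorD_tmul {j : ℤ} {z : M} (hz : z ∈ ℳ.gr j) (y : N) :
    ℳ.tensorD 𝒩 (ℳ.tmul z y) = ℳ.tmul (ℳ.d z) y + dgSign j • ℳ.tmul z (𝒩.d y) := by
  simp only [tensorD, tmul, Submodule.mkQ_apply, Submodule.mapQ_apply, ℳ.tensorPreD_tmul 𝒩 hz]
  rfl

theorem tmul_mem {i j k : ℤ} {z : M} {y : N} (hz : z ∈ ℳ.gr i) (hy : y ∈ 𝒩.gr j)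
    (h : i + j = k) : ℳ.tmul z y ∈ ℳ.tensorGr 𝒩 k :=
  AddSubgroup.subset_closure ⟨i, j, z, y, hz, hy, h, rfl⟩

theorem tensor_induction {P : ℳ.TensorObj N → Prop} (t : ℳ.TensorObj N) (zero : P 0)
    (tmul : ∀ (i j : ℤ) (z : M) (y : N), z ∈ ℳ.gr i → y ∈ 𝒩.gr j → P (ℳ.tmul z y))
    (add : ∀ s t, P s → P t → P (s + t)) : P t := by
  obtain ⟨t, rfl⟩ := Submodule.mkQ_surjective _ t
  induction t using TensorProduct.induction_on with
  | zero => simpa using zero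
  | add s t hs ht => rw [map_add]; exact add _ _ hs ht
  | tmul z y =>
    induction z using ℳ.toDGComplex.induction_on with
    | zero => simpa using zero
    | add z z' h h' => rw [TensorProduct.add_tmul, map_add]; exact add _ _ h h'
    | hom i z hz =>
      induction y using 𝒩.toDGComplex.induction_on with
      | zero => simpa using zero
      | add y y' h h' => rw [TensorProduct.tmul_add, map_add]; exact add _ _ h h'
      | hom j y hy => exact tmul i j z y hz hy

/-- The map `z ⊗ y ↦ z ⊗ y` from homogeneous elements to the component of degree `i + j`. -/
noncomputable def grMul (i j : ℤ) : ℳ.gr i →+ 𝒩.gr j →+ ℳ.tensorGr 𝒩 (i + j) :=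
  AddMonoidHom.mk' (fun z => AddMonoidHom.mk'
    (fun y => ⟨ℳ.tmul (z : M) (y : N), ℳ.tmul_mem 𝒩 z.2 y.2 rfl⟩)
    (fun y y' => Subtype.ext (by simp [tmul, TensorProduct.tmul_add])))
    (fun z z' => by ext y; simp [tmul, TensorProduct.add_tmul])

/-- The splitting of the tensor product over `ℤ` into components. -/
noncomputable def preSplit : M ⊗[ℤ] N →+ ⨁ k, ℳ.tensorGr 𝒩 k :=
  TensorProduct.liftAddHom
    ((AddMonoidHom.compHom' 𝒩.decomp.toAddMonoidHom).comp
      ((DirectSum.toAddMonoid fun i => AddMonoidHom.flip (DirectSum.toAddMonoid fun j =>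
        AddMonoidHom.flip ((AddMonoidHom.compHom
          (DirectSum.of (fun k => ℳ.tensorGr 𝒩 k) (i + j))).comp (ℳ.grMul 𝒩 i j)))).comp
      ℳ.decomp.toAddMonoidHom))
    (by intro r z y; simp)

theorem preSplit_tmul {i j k : ℤ} {z : M} {y : N} (hz : z ∈ ℳ.gr i) (hy : y ∈ 𝒩.gr j)
    (h : i + j = k) : ℳ.preSplit 𝒩 (z ⊗ₜ y) =
      DirectSum.of (fun k => ℳ.tensorGr 𝒩 k) k ⟨ℳ.tmul z y, ℳ.tmul_mem 𝒩 hz hy h⟩ := by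
  subst h
  simp [preSplit, ℳ.decomp_of_mem hz, 𝒩.decomp_of_mem hy]
  rfl

theorem tmul_balanced {i j : ℤ} {a : A} {z : M} (ha : a ∈ 𝒜.gr i) (hz : z ∈ ℳ.gr j) (y : N) :
    ℳ.tmul (dgSign (i * j) • (a • z)) y = ℳ.tmul z (a • y) :=
  (Submodule.Quotient.eq _).2 (Submodule.subset_span ⟨i, j, a, z, y, ha, hz, rfl⟩)

theorem preSplit_rel : ℳ.tensorRel N ≤ LinearMap.ker (ℳ.preSplit 𝒩).toIntLinearMap := by
  refine Submodule.span_le.2 ?_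
  rintro _ ⟨i, j, a, z, y, ha, hz, rfl⟩
  rw [SetLike.mem_coe, LinearMap.mem_ker, map_sub, sub_eq_zero, AddMonoidHom.coe_toIntLinearMap]
  induction y using 𝒩.toDGComplex.induction_on with
  | zero => simp
  | add y y' h h' => rw [TensorProduct.tmul_add, smul_add, TensorProduct.tmul_add, map_add,
      map_add, h, h']
  | hom l y hy =>
    rw [ℳ.preSplit_tmul 𝒩 (zsmul_mem (ℳ.smul_mem ha hz) _) hy (show i + j + l = i + j + l from rfl),
      ℳ.preSplit_tmul 𝒩 hz (𝒩.smul_mem ha hy) (show j + (i + l) = i + j + l by ring)]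
    congr 1
    exact Subtype.ext (ℳ.tmul_balanced ha hz y)

/-- The splitting of the tensor product into components. -/
noncomputable def split : ℳ.TensorObj N →+ ⨁ k, ℳ.tensorGr 𝒩 k :=
  ((ℳ.tensorRel N).liftQ (ℳ.preSplit 𝒩).toIntLinearMap (ℳ.preSplit_rel 𝒩)).toAddMonoidHom

theorem split_tmul {i j k : ℤ} {z : M} {y : N} (hz : z ∈ ℳ.gr i) (hy : y ∈ 𝒩.gr j)
    (h : i + j = k) : ℳ.split 𝒩 (ℳ.tmul z y) =
      DirectSum.of (fun k => ℳ.tensorGr 𝒩 k) k ⟨ℳ.tmul z y, ℳ.tmul_mem 𝒩 hz hy h⟩ :=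
  ℳ.preSplit_tmul 𝒩 hz hy h

theorem split_of_mem {k : ℤ} (t : ℳ.tensorGr 𝒩 k) :
    ℳ.split 𝒩 t = DirectSum.of (fun k => ℳ.tensorGr 𝒩 k) k t := by
  obtain ⟨t, ht⟩ := t
  induction ht using AddSubgroup.closure_induction with
  | mem t h =>
    obtain ⟨i, j, z, y, hz, hy, h, rfl⟩ := h
    exact ℳ.split_tmul 𝒩 hz hy h
  | zero => exact (map_zero _).trans (map_zero _).symm
  | add s t hs ht h h' =>
    rw [map_add, h, h', ← map_add]; rfl
  | neg t ht h => rw [map_neg, h, ← map_neg]; rfl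

theorem tensor_isInternal : DirectSum.IsInternal (ℳ.tensorGr 𝒩) := by
  refine ⟨Function.LeftInverse.injective (g := ℳ.split 𝒩) fun t => ?_,
    Function.RightInverse.surjective (g := ℳ.split 𝒩) fun t => ?_⟩
  · induction t using DirectSum.induction_on with
    | zero => simp
    | of k t => rw [DirectSum.coeAddMonoidHom_of, split_of_mem]
    | add s t hs ht => rw [map_add, map_add, hs, ht]
  · induction t using ℳ.tensor_induction 𝒩 with
    | zero => simp
    | tmul i j z y hz hy => rw [ℳ.split_tmul 𝒩 hz hy rfl, DirectSum.coeAddMonoidHom_of]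
    | add s t hs ht => rw [map_add, map_add, hs, ht]

theorem tensorD_mem {k : ℤ} {t : ℳ.TensorObj N} (ht : t ∈ ℳ.tensorGr 𝒩 k) :
    ℳ.tensorD 𝒩 t ∈ ℳ.tensorGr 𝒩 (k - 1) := by
  induction ht using AddSubgroup.closure_induction with
  | mem t h =>
    obtain ⟨i, j, z, y, hz, hy, h, rfl⟩ := h
    rw [ℳ.tensorD_tmul 𝒩 hz]
    exact add_mem (ℳ.tmul_mem 𝒩 (ℳ.d_mem hz) hy (by lia))
      (zsmul_mem (ℳ.tmul_mem 𝒩 hz (𝒩.d_mem hy) (by lia)) _)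
  | zero => rw [map_zero]; exact zero_mem _
  | add s t hs ht h h' => rw [map_add]; exact add_mem h h'
  | neg t ht h => rw [map_neg]; exact neg_mem h

theorem tensorD_tensorD (t : ℳ.TensorObj N) : ℳ.tensorD 𝒩 (ℳ.tensorD 𝒩 t) = 0 := by
  induction t using ℳ.tensor_induction 𝒩 with
  | zero => rw [map_zero, map_zero]
  | add s t hs ht => rw [map_add, map_add, hs, ht, add_zero]
  | tmul i j z y hz hy =>
    have h0 : ℳ.tmul (0 : M) y = 0 := by simp [tmul]
    have h1 : ℳ.tmul z (0 : N) = 0 := by simp [tmul]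
    rw [ℳ.tensorD_tmul 𝒩 hz, map_add, map_zsmul, ℳ.tensorD_tmul 𝒩 hz,
      ℳ.tensorD_tmul 𝒩 (ℳ.d_mem hz), ℳ.d_d, 𝒩.d_d, h0, h1, dgSign_sub_one]
    simp

/-- The tensor product `ℳ ⊗_𝒜 𝒩` of DG modules, as a complex. -/
noncomputable def tensor : DGComplex (ℳ.TensorObj N) where
  gr := ℳ.tensorGr 𝒩
  isInternal := ℳ.tensor_isInternal 𝒩
  d := (ℳ.tensorD 𝒩).toAddMonoidHom
  d_mem := ℳ.tensorD_mem 𝒩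
  d_d := ℳ.tensorD_tensorD 𝒩

end Tensor

/-- The derived tensor product `ℳ ⊗^L_𝒜 𝒩`, computed by the semifree resolution `r : F → ℳ` as
`F ⊗_𝒜 𝒩`. -/
noncomputable def SemifreeResolution.derivedTensor
    {M : Type v} [AddCommGroup M] [Module A M] {ℳ : DGModule 𝒜 M}
    (r : SemifreeResolution.{u, v, x} ℳ)
    {N : Type w} [AddCommGroup N] [Module A N] (𝒩 : DGModule 𝒜 N) :
    DGComplex (r.dgModule.TensorObj N) :=
  r.dgModule.tensor 𝒩

end DGModule

/-! Both bounds follow from one claim: if `H_k` of the derived tensor product is nonzero, then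
`H_{k-j}(Y)` is nonzero for some `j` with `n ≤ j ≤ n + m`. Its contrapositive is a statement about
exactness in the single degree `k`.

For `L ⊗ Y` itself, filter by the degree of the semibasis elements. Since `A` is positively graded,
`d b` only involves basis elements of degree smaller than that of `b`, so the differential respects
the filtration and acts on each layer as `± b ⊗ dy`. Each layer is thus a sum of shifted copies of
`Y`. A cycle is pushed down one layer at a time by subtracting boundaries, and the process ends
because the degrees of the semibasis are bounded (`exactAt_tensor_of_basis`).

The derived tensor product uses an arbitrary semifree resolution `F → L`, whose semibasis need not
be bounded above. However, a quasiisomorphism onto a semifree module has a right inverse up to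
homotopy (`exists_homotopyToId`). Applied twice, this makes `F` a homotopy retract of `L`; tensoring
with `Y` preserves the homotopy, so exactness passes from `L ⊗ Y` to `F ⊗ Y`. -/

theorem dgSign_congr {i j : ℤ} (h : Even (i - j)) : dgSign i = dgSign j := by
  rw [dgSign, dgSign, (Int.negOnePow_eq_iff i j).2 h]

theorem dgSign_smul_smul {M : Type u} [AddCommGroup M] (i : ℤ) (z : M) :
    dgSign i • dgSign i • z = z := by
  rw [smul_smul, dgSign_mul_self, one_smul]

/-! ### Homogeneous components and exactness in a single degree. -/

namespace DGComplex

variable {M : Type u} [AddCommGroup M] (C : DGComplex M)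

/-- The projection onto the component of degree `i`. -/
noncomputable def component (i : ℤ) : M →+ M :=
  (C.gr i).subtype.comp ((DFinsupp.evalAddMonoidHom i).comp C.decomp.toAddMonoidHom)

theorem component_of_mem {i : ℤ} {z : M} (hz : z ∈ C.gr i) : C.component i z = z := by
  change ((C.decomp z i : C.gr i) : M) = z
  rw [C.decomp_of_mem hz, DirectSum.of_eq_same]

theorem component_of_mem_ne {i j : ℤ} {z : M} (hz : z ∈ C.gr j) (h : j ≠ i) :
    C.component i z = 0 := by
  change ((C.decomp z i : C.gr i) : M) = 0
  rw [C.decomp_of_mem hz, DirectSum.of_eq_of_ne _ _ _ h.symm, ZeroMemClass.coe_zero]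

/-- The projection onto degree `i` fixes `S i` and kills every other `S j`, so homogeneous
generators of the whole group yield generators of each component. -/
theorem gr_le_closure {S : ℤ → Set M} (hS : ∀ i, S i ⊆ C.gr i)
    (h : ∀ z : M, z ∈ AddSubgroup.closure (⋃ i, S i)) (i : ℤ) :
    C.gr i ≤ AddSubgroup.closure (S i) := by
  have key : ∀ z : M, C.component i z ∈ AddSubgroup.closure (S i) := by
    intro z
    induction h z using AddSubgroup.closure_induction with
    | mem z hz =>
      obtain ⟨j, hj⟩ := Set.mem_iUnion.1 hz
      by_cases hij : j = i
      · subst hij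
        rw [C.component_of_mem (hS _ hj)]
        exact AddSubgroup.subset_closure hj
      · rw [C.component_of_mem_ne (hS _ hj) hij]
        exact zero_mem _
    | zero => rw [map_zero]; exact zero_mem _
    | add s t _ _ h h' => rw [map_add]; exact add_mem h h'
    | neg t _ h => rw [map_neg]; exact neg_mem h
  intro z hz
  rw [← C.component_of_mem hz]
  exact key z

/-- The additive map which multiplies homogeneous elements of degree `i` by `(-1) ^ (i * e)`. -/
noncomputable def twistBy (e : ℤ) : M →+ M :=
  (DirectSum.toAddMonoid fun i => dgSign (i * e) • (C.gr i).subtype).comp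
    C.decomp.toAddMonoidHom

theorem twistBy_of_mem (e : ℤ) {i : ℤ} {z : M} (hz : z ∈ C.gr i) :
    C.twistBy e z = dgSign (i * e) • z := by
  simp [twistBy, C.decomp_of_mem hz]

/-- Every cycle of degree `k` is a boundary. -/
def ExactAt (k : ℤ) : Prop := ∀ z ∈ C.gr k, C.d z = 0 → ∃ u ∈ C.gr (k + 1), C.d u = z

theorem exactAt_iff (k : ℤ) : C.ExactAt k ↔ ¬ Nontrivial (C.Homology k) := by
  rw [not_nontrivial_iff_subsingleton]
  constructor
  · intro h
    refine subsingleton_of_forall_eq 0 fun t => ?_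
    obtain ⟨⟨z, hz, hz'⟩, rfl⟩ := QuotientAddGroup.mk_surjective t
    exact (QuotientAddGroup.eq_zero_iff _).2 (h z hz hz')
  · intro h z hz hz'
    exact (QuotientAddGroup.eq_zero_iff (⟨z, hz, hz'⟩ : C.cycles k)).1
      (@Subsingleton.elim (C.Homology k) h _ _)

end DGComplex

/-! ### Quasiisomorphisms and homotopies in terms of elements. -/

namespace DGHom

variable {A : Type u} [Ring A] {𝒜 : DGAlgebra A}
  {M : Type v} [AddCommGroup M] [Module A M] {ℳ : DGModule 𝒜 M}
  {N : Type w} [AddCommGroup N] [Module A N] {𝒩 : DGModule 𝒜 N} (f : DGHom ℳ 𝒩)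

/-- Injectivity on homology, in terms of elements. -/
def ReflectsBoundaries : Prop := ∀ (i : ℤ), ∀ c ∈ ℳ.gr i, ℳ.d c = 0 →
  ∀ u ∈ 𝒩.gr (i + 1), 𝒩.d u = f.toFun c → ∃ t ∈ ℳ.gr (i + 1), ℳ.d t = c

/-- Surjectivity on homology, in terms of elements. -/
def LiftsCycles : Prop := ∀ (i : ℤ), ∀ c ∈ 𝒩.gr i, 𝒩.d c = 0 →
  ∃ t ∈ ℳ.gr i, ℳ.d t = 0 ∧ ∃ u ∈ 𝒩.gr (i + 1), c = f.toFun t + 𝒩.d u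

variable {f}

theorem IsQuasiIso.reflectsBoundaries (h : f.IsQuasiIso) : f.ReflectsBoundaries := by
  intro i c hc hc' u hu huc
  have h1 : f.homologyMap i (QuotientAddGroup.mk (⟨c, hc, hc'⟩ : ℳ.cycles i)) = 0 :=
    (QuotientAddGroup.eq_zero_iff (f.cyclesMap i ⟨c, hc, hc'⟩)).2 ⟨u, hu, huc⟩
  exact (QuotientAddGroup.eq_zero_iff (⟨c, hc, hc'⟩ : ℳ.cycles i)).1
    ((h i).1 (h1.trans (map_zero _).symm))

theorem IsQuasiIso.liftsCycles (h : f.IsQuasiIso) : f.LiftsCycles := by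
  intro i c hc hc'
  obtain ⟨t, ht⟩ := (h i).2 (QuotientAddGroup.mk (⟨c, hc, hc'⟩ : 𝒩.cycles i))
  obtain ⟨⟨t, ht1, ht2⟩, rfl⟩ := QuotientAddGroup.mk_surjective t
  obtain ⟨u, hu, hu'⟩ := QuotientAddGroup.eq.1 ht
  change 𝒩.d u = -f.toFun t + c at hu'
  exact ⟨t, ht1, ht2, u, hu, by rw [hu']; abel⟩

/-- `k` is a homotopy from `q ∘ g` to the identity: `z ↦ (-1) ^ |z| k z` is a map of degree `1`
with `q g - 1 = d k + k d`, written for the `A`-linear map `k`. -/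
structure IsHomotopyToId (q : DGHom ℳ 𝒩) (g : DGHom 𝒩 ℳ) (k : N →ₗ[A] N) : Prop where
  map_mem : ∀ {i : ℤ} {z : N}, z ∈ 𝒩.gr i → k z ∈ 𝒩.gr (i + 1)
  map_d : ∀ {i : ℤ} {z : N}, z ∈ 𝒩.gr i →
    𝒩.d (k z) - k (𝒩.d z) = dgSign i • (q.toFun (g.toFun z) - z)

variable {g : DGHom 𝒩 ℳ} {k : N →ₗ[A] N}

theorem IsHomotopyToId.exists_boundary (h : IsHomotopyToId f g k) {i : ℤ} {c : N}
    (hc : c ∈ 𝒩.gr i) (hc' : 𝒩.d c = 0) :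
    ∃ u ∈ 𝒩.gr (i + 1), 𝒩.d u = f.toFun (g.toFun c) - c := by
  refine ⟨dgSign i • k c, zsmul_mem (h.map_mem hc) _, ?_⟩
  have := h.map_d hc
  rw [hc', map_zero, sub_zero] at this
  rw [map_zsmul, this, dgSign_smul_smul]

theorem IsHomotopyToId.reflectsBoundaries (h : IsHomotopyToId f g k) :
    g.ReflectsBoundaries := by
  intro i c hc hc' u hu huc
  obtain ⟨t, ht, htc⟩ := h.exists_boundary hc hc'
  refine ⟨f.toFun u - t, sub_mem (f.map_mem hu) ht, ?_⟩
  rw [map_sub, ← f.map_d, huc, htc]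
  abel

/-- For a cycle `c`, the homotopy makes `f g f c` homologous to `f c`; as `f` is injective on
homology, `g f c` is homologous to `c`. Hence `f c` is the required lift. -/
theorem IsHomotopyToId.liftsCycles (h : IsHomotopyToId f g k) (hf : f.ReflectsBoundaries) :
    g.LiftsCycles := by
  intro i c hc hc'
  have hfc : 𝒩.d (f.toFun c) = 0 := by rw [← f.map_d, hc', map_zero]
  obtain ⟨t, ht, htc⟩ := h.exists_boundary (f.map_mem hc) hfc
  obtain ⟨u, hu, huc⟩ := hf i (g.toFun (f.toFun c) - c)
    (sub_mem (g.map_mem (f.map_mem hc)) hc)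
    (by rw [map_sub, ← g.map_d, hfc, hc', map_zero, sub_zero]) t ht
    (by rw [htc, map_sub])
  exact ⟨f.toFun c, f.map_mem hc, hfc, -u, neg_mem hu, by rw [map_neg, huc]; abel⟩

end DGHom

/-! ### Homogeneous elements in terms of a semibasis. -/

namespace DGModule

variable {A : Type u} [Ring A] {𝒜 : DGAlgebra A}
  {M : Type v} [AddCommGroup M] [Module A M] {ℳ : DGModule 𝒜 M}

theorem IsSemibasis.exists_basis {B : Set M} (hB : ℳ.IsSemibasis B) :
    ∃ b : Module.Basis B A M, ∀ i, b i = (i : M) :=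
  ⟨Module.Basis.mk hB.linearIndependent (by rw [Subtype.range_coe, hB.span_eq_top]), fun i => by
    rw [Module.Basis.mk_apply]⟩

/-- This is where positivity of the grading enters: a nonzero homogeneous coefficient has degree at
least `0`, so only basis elements of degree at most `i` can occur in degree `i`. In particular `d b`
only involves basis elements of lower degree, which drives every induction below. -/
theorem mem_closure_of_mem_gr (hA : 𝒜.PositivelyGraded) {ι : Type w} (b : Module.Basis ι A M)
    {deg : ι → ℤ} (hb : ∀ j, b j ∈ ℳ.gr (deg j)) {i : ℤ} {z : M} (hz : z ∈ ℳ.gr i) :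
    z ∈ AddSubgroup.closure
      {z | ∃ (j : ι) (a : A), deg j ≤ i ∧ a ∈ 𝒜.gr (i - deg j) ∧ z = a • b j} := by
  refine ℳ.gr_le_closure (S := fun i => {z | ∃ (j : ι) (a : A), deg j ≤ i ∧
    a ∈ 𝒜.gr (i - deg j) ∧ z = a • b j}) ?_ ?_ i hz
  · rintro i _ ⟨j, a, -, ha, rfl⟩
    have := ℳ.smul_mem ha (hb j)
    rwa [sub_add_cancel] at this
  · intro z
    have hsmul : ∀ (a : A) (j : ι), a • b j ∈ AddSubgroup.closure (⋃ i, {z | ∃ (j : ι) (a : A),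
        deg j ≤ i ∧ a ∈ 𝒜.gr (i - deg j) ∧ z = a • b j}) := by
      intro a j
      induction a using 𝒜.toDGComplex.induction_on with
      | zero => rw [zero_smul]; exact zero_mem _
      | add a a' h h' => rw [add_smul]; exact add_mem h h'
      | hom l a ha =>
        by_cases hl : l < 0
        · rw [hA l hl, AddSubgroup.mem_bot] at ha
          rw [ha, zero_smul]
          exact zero_mem _
        · exact AddSubgroup.subset_closure (Set.mem_iUnion.2
            ⟨l + deg j, j, a, by lia, by rwa [add_sub_cancel_right], rfl⟩)
    rw [← b.linearCombination_repr z, Finsupp.linearCombination_apply]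
    exact AddSubgroup.sum_mem _ fun j _ => hsmul _ j

end DGModule

/-- Choosing values one after the other, along a rank function: `Q φ i x` says that `x` is
admissible at `i` once the values `φ` of smaller rank have been chosen. -/
theorem exists_forall_of_rank {ι : Type u} {X : Type v} [Nonempty X] (rank : ι → ℕ)
    (Q : (ι → X) → ι → X → Prop)
    (local_dep : ∀ (φ ψ : ι → X) (i : ι) (x : X), (∀ j, rank j < rank i → φ j = ψ j) →
      Q φ i x → Q ψ i x)
    (step : ∀ (φ : ι → X) (i : ι), (∀ j, rank j < rank i → Q φ j (φ j)) → ∃ x, Q φ i x) :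
    ∃ φ : ι → X, ∀ i, Q φ i (φ i) := by
  classical
  -- The default value at indices of larger or equal rank is irrelevant because of `local_dep`.
  let ext (i : ι) (rec : ∀ j, rank j < rank i → X) : ι → X := fun j =>
    if h : rank j < rank i then rec j h else Classical.arbitrary X
  let F (i : ι) (rec : ∀ j, rank j < rank i → X) : X := Classical.epsilon (Q (ext i rec) i)
  let φ : ι → X := (measure rank).wf.fix F
  have hφ : ∀ i, φ i = F i fun j _ => φ j := fun i => (measure rank).wf.fix_eq F i
  have hext : ∀ i j, rank j < rank i → ext i (fun j _ => φ j) j = φ j := fun i j h => dif_pos h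
  refine ⟨φ, fun i => ?_⟩
  induction i using (measure rank).wf.induction with
  | h i ih =>
    obtain ⟨x, hx⟩ := step φ i ih
    have h1 : Q (ext i fun j _ => φ j) i x :=
      local_dep _ _ i x (fun j hj => (hext i j hj).symm) hx
    have h2 : Q (ext i fun j _ => φ j) i (φ i) := by
      rw [hφ i]
      exact Classical.epsilon_spec ⟨x, h1⟩
    exact local_dep _ _ i _ (fun j hj => hext i j hj) h2

/-! ### Lifting up to homotopy against quasiisomorphisms onto semifree modules. -/

namespace DGModule

variable {A : Type u} [Ring A] {𝒜 : DGAlgebra A}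
  {M : Type v} [AddCommGroup M] [Module A M] {ℳ : DGModule 𝒜 M}
  {P : Type w} [AddCommGroup P] [Module A P] {𝒬 : DGModule 𝒜 P}

section Extension

variable {ι : Type x} {b : Module.Basis ι A M} {deg : ι → ℤ}

/-- Used to see that the values on `d (b i)` of a map under construction depend only on choices
already made. -/
theorem linearMap_eq_of_mem_gr (hA : 𝒜.PositivelyGraded) (hb : ∀ j, b j ∈ ℳ.gr (deg j))
    {f f' : M →ₗ[A] P} {p : ℤ} (h : ∀ j, deg j ≤ p → f (b j) = f' (b j)) {z : M}
    (hz : z ∈ ℳ.gr p) : f z = f' z := by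
  have hz' := mem_closure_of_mem_gr hA b hb hz
  clear hz
  induction hz' using AddSubgroup.closure_induction with
  | mem z hz =>
    obtain ⟨j, a, hj, -, rfl⟩ := hz
    rw [map_smul, map_smul, h j hj]
  | zero => simp
  | add s t _ _ h h' => rw [map_add, map_add, h, h']
  | neg t _ h => rw [map_neg, map_neg, h]

theorem linearMap_mem_of_mem_gr (hA : 𝒜.PositivelyGraded) (hb : ∀ j, b j ∈ ℳ.gr (deg j))
    {f : M →ₗ[A] P} {p e : ℤ} (h : ∀ j, deg j ≤ p → f (b j) ∈ 𝒬.gr (deg j + e)) {z : M}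
    (hz : z ∈ ℳ.gr p) : f z ∈ 𝒬.gr (p + e) := by
  have hz' := mem_closure_of_mem_gr hA b hb hz
  clear hz
  induction hz' using AddSubgroup.closure_induction with
  | mem z hz =>
    obtain ⟨j, a, hj, ha, rfl⟩ := hz
    rw [map_smul]
    have := 𝒬.smul_mem ha (h j hj)
    rwa [show p - deg j + (deg j + e) = p + e by ring] at this
  | zero => rw [map_zero]; exact zero_mem _
  | add s t _ _ h h' => rw [map_add]; exact add_mem h h'
  | neg t _ h => rw [map_neg]; exact neg_mem h

/-- A relation `d k - k d = ± f` extends from a basis to the module. -/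
theorem linearMap_d_of_mem_gr (hA : 𝒜.PositivelyGraded) (hb : ∀ j, b j ∈ ℳ.gr (deg j))
    {k f : M →ₗ[A] P} {p : ℤ}
    (h : ∀ j, deg j ≤ p → 𝒬.d (k (b j)) - k (ℳ.d (b j)) = dgSign (deg j) • f (b j)) {z : M}
    (hz : z ∈ ℳ.gr p) : 𝒬.d (k z) - k (ℳ.d z) = dgSign p • f z := by
  have hz' := mem_closure_of_mem_gr hA b hb hz
  clear hz
  induction hz' using AddSubgroup.closure_induction with
  | mem z hz =>
    obtain ⟨j, a, hj, ha, rfl⟩ := hz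
    rw [map_smul k, map_smul f, 𝒬.leibniz _ ha, ℳ.leibniz _ ha, map_add, map_smul k, map_zsmul,
      map_smul k, add_sub_add_left_eq_sub, ← smul_sub, ← smul_sub, h j hj,
      smul_comm a, smul_smul, ← dgSign_add, sub_add_cancel]
  | zero => simp
  | add s t _ _ h h' =>
    simp only [map_add, smul_add, ← h, ← h']
    abel
  | neg t _ h => simp only [map_neg, smul_neg, ← h]; abel

end Extension

variable {ι : Type x} (b : Module.Basis ι A M)

/-- A quasiisomorphism onto a semifree DG module over a positively graded DG algebra has a right
inverse up to homotopy. -/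
theorem exists_homotopyToId (hA : 𝒜.PositivelyGraded) {deg : ι → ℤ}
    (hb : ∀ j, b j ∈ ℳ.gr (deg j)) {N : ℤ} (hN : ∀ j, N ≤ deg j) (q : DGHom 𝒬 ℳ)
    (hinj : q.ReflectsBoundaries) (hsurj : q.LiftsCycles) :
    ∃ (g : DGHom ℳ 𝒬) (k : M →ₗ[A] M), DGHom.IsHomotopyToId q g k := by
  let G (φ : ι → P × M) : M →ₗ[A] P := b.constr ℤ fun j => (φ j).1
  let K (φ : ι → P × M) : M →ₗ[A] M := b.constr ℤ fun j => (φ j).2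
  have hG : ∀ φ j, G φ (b j) = (φ j).1 := fun φ j => b.constr_basis ℤ _ j
  have hK : ∀ φ j, K φ (b j) = (φ j).2 := fun φ j => b.constr_basis ℤ _ j
  -- The pair `x` is the candidate for `(g (b j), k (b j))`. The last two conditions are the chain
  -- map identity and the homotopy identity at `b j`.
  let Q (φ : ι → P × M) (j : ι) (x : P × M) : Prop :=
    x.1 ∈ 𝒬.gr (deg j) ∧ x.2 ∈ ℳ.gr (deg j + 1) ∧ 𝒬.d x.1 = G φ (ℳ.d (b j)) ∧
      ℳ.d x.2 - K φ (ℳ.d (b j)) = dgSign (deg j) • (q.toFun x.1 - b j)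
  have rank_lt : ∀ i j, deg j ≤ deg i - 1 → (deg j - N).toNat < (deg i - N).toNat := by
    intro i j h
    have := hN j
    lia
  have hex : ∃ φ : ι → P × M, ∀ i, Q φ i (φ i) := by
    refine exists_forall_of_rank (fun j => (deg j - N).toNat) Q ?_ ?_
    · rintro φ ψ i x h ⟨hx1, hx2, hx3, hx4⟩
      have e1 : G φ (ℳ.d (b i)) = G ψ (ℳ.d (b i)) :=
        linearMap_eq_of_mem_gr hA hb (fun j hj => by rw [hG, hG, h j (rank_lt i j hj)])
          (ℳ.d_mem (hb i))
      have e2 : K φ (ℳ.d (b i)) = K ψ (ℳ.d (b i)) :=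
        linearMap_eq_of_mem_gr hA hb (fun j hj => by rw [hK, hK, h j (rank_lt i j hj)])
          (ℳ.d_mem (hb i))
      exact ⟨hx1, hx2, e1 ▸ hx3, e2 ▸ hx4⟩
    · intro φ i ih
      have hd := ℳ.d_mem (hb i)
      set p := deg i with hp
      have g_mem : G φ (ℳ.d (b i)) ∈ 𝒬.gr (p - 1) := by
        have := linearMap_mem_of_mem_gr (𝒬 := 𝒬) (f := G φ) (e := 0) hA hb
          (fun j hj => by rw [hG, add_zero]; exact (ih j (rank_lt i j hj)).1) hd
        rwa [add_zero] at this
      have k_mem : K φ (ℳ.d (b i)) ∈ ℳ.gr p := by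
        have := linearMap_mem_of_mem_gr (𝒬 := ℳ) (f := K φ) (e := 1) hA hb
          (fun j hj => by rw [hK]; exact (ih j (rank_lt i j hj)).2.1) hd
        rwa [sub_add_cancel] at this
      have g_d : 𝒬.d (G φ (ℳ.d (b i))) = 0 := by
        have := linearMap_d_of_mem_gr (𝒬 := 𝒬) (k := G φ) (f := 0) hA hb
          (fun j hj => by rw [hG, (ih j (rank_lt i j hj)).2.2.1]; simp) hd
        simpa [ℳ.d_d] using this
      have k_d : ℳ.d (K φ (ℳ.d (b i))) =
          dgSign (p - 1) • (q.toFun (G φ (ℳ.d (b i))) - ℳ.d (b i)) := by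
        have := linearMap_d_of_mem_gr (𝒬 := ℳ) (k := K φ) (f := q.toFun ∘ₗ G φ - LinearMap.id) hA hb
          (fun j hj => by simpa [hG, hK] using (ih j (rank_lt i j hj)).2.2.2) hd
        simpa [ℳ.d_d] using this
      -- The value `x` must satisfy `d x = g (d b)`. The homotopy identity at `d b` exhibits `q g (d
      -- b)` as the boundary of `b ± k (d b)`, so injectivity on homology supplies `x`.
      obtain ⟨x, hx, hdx⟩ := hinj (p - 1) _ g_mem g_d (b i + dgSign (p - 1) • K φ (ℳ.d (b i)))
        (by rw [sub_add_cancel]; exact add_mem (hb i) (zsmul_mem k_mem _))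
        (by rw [map_add, map_zsmul, k_d, dgSign_smul_smul]; abel)
      rw [sub_add_cancel] at hx
      -- The defect in the homotopy identity at `b` is a cycle, hence equals `q t + d w` with `t` a
      -- cycle. Replacing `x` by `x ∓ t` keeps `d x` and leaves the defect `d w`, so `w` serves as
      -- `k b`.
      obtain ⟨t, ht, hdt, w, hw, hv⟩ := hsurj p
        (dgSign p • (q.toFun x - b i) + K φ (ℳ.d (b i)))
        (add_mem (zsmul_mem (sub_mem (q.map_mem hx) (hb i)) _) k_mem)
        (by rw [map_add, map_zsmul, map_sub, ← q.map_d, hdx, k_d, dgSign_sub_one, neg_smul,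
              add_neg_cancel])
      refine ⟨(x - dgSign p • t, w), sub_mem hx (zsmul_mem ht _), hw, ?_, ?_⟩
      · rw [map_sub, map_zsmul, hdt, smul_zero, sub_zero, hdx]
      · change ℳ.d w - K φ (ℳ.d (b i)) = dgSign p • (q.toFun (x - dgSign p • t) - b i)
        rw [map_sub, map_zsmul, sub_right_comm, smul_sub _ (q.toFun x - b i), dgSign_smul_smul,
          sub_eq_sub_iff_add_eq_add, hv]
        abel
  obtain ⟨φ, hφ⟩ := hex
  have h1 : ∀ {i : ℤ} {z : M}, z ∈ ℳ.gr i → G φ z ∈ 𝒬.gr i := fun {i z} hz => by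
    have := linearMap_mem_of_mem_gr (𝒬 := 𝒬) (f := G φ) (e := 0) hA hb
      (fun j _ => by rw [hG, add_zero]; exact (hφ j).1) hz
    rwa [add_zero] at this
  have h3 : ∀ z, G φ (ℳ.d z) = 𝒬.d (G φ z) := fun z => by
    induction z using ℳ.toDGComplex.induction_on with
    | zero => simp
    | add s t h h' => simp only [map_add, h, h']
    | hom i z hz =>
      have := linearMap_d_of_mem_gr (𝒬 := 𝒬) (k := G φ) (f := 0) hA hb
        (fun j _ => by rw [hG, (hφ j).2.2.1]; simp) hz
      rw [LinearMap.zero_apply, smul_zero, sub_eq_zero] at this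
      exact this.symm
  refine ⟨⟨G φ, h1, h3⟩, K φ, ?_, ?_⟩
  · intro i z hz
    exact linearMap_mem_of_mem_gr hA hb (fun j _ => by rw [hK]; exact (hφ j).2.1) hz
  · intro i z hz
    exact linearMap_d_of_mem_gr (𝒬 := ℳ) (k := K φ) (f := q.toFun ∘ₗ G φ - LinearMap.id) hA hb
      (fun j _ => by simpa [hG, hK] using (hφ j).2.2.2) hz

end DGModule

/-! ### Functoriality of the tensor product and its homotopy invariance. -/

namespace DGModule

variable {A : Type u} [Ring A] {𝒜 : DGAlgebra A}
  {M : Type v} [AddCommGroup M] [Module A M] (ℳ : DGModule 𝒜 M)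
  {P : Type w} [AddCommGroup P] [Module A P] (𝒬 : DGModule 𝒜 P)
  {N : Type x} [AddCommGroup N] [Module A N] (𝒩 : DGModule 𝒜 N)

/-- `z ⊗ y` as a bilinear map. -/
def tmulHom (N : Type x) [AddCommGroup N] [Module A N] : M →ₗ[ℤ] N →ₗ[ℤ] ℳ.TensorObj N :=
  (TensorProduct.mk ℤ M N).compr₂ (ℳ.tensorRel N).mkQ

theorem add_tmul (z z' : M) (y : N) : ℳ.tmul (z + z') y = ℳ.tmul z y + ℳ.tmul z' y :=
  (ℳ.tmulHom N).map_add₂ z z' y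

theorem sub_tmul (z z' : M) (y : N) : ℳ.tmul (z - z') y = ℳ.tmul z y - ℳ.tmul z' y :=
  (ℳ.tmulHom N).map_sub₂ z z' y

theorem neg_tmul (z : M) (y : N) : ℳ.tmul (-z) y = -ℳ.tmul z y :=
  (ℳ.tmulHom N).map_neg₂ z y

theorem zero_tmul (y : N) : ℳ.tmul (0 : M) y = 0 :=
  (ℳ.tmulHom N).map_zero₂ y

theorem zsmul_tmul (l : ℤ) (z : M) (y : N) : ℳ.tmul (l • z) y = l • ℳ.tmul z y :=
  (ℳ.tmulHom N).map_smul₂ l z y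

theorem tmul_add (z : M) (y y' : N) : ℳ.tmul z (y + y') = ℳ.tmul z y + ℳ.tmul z y' :=
  (ℳ.tmulHom N z).map_add y y'

theorem tmul_zero (z : M) : ℳ.tmul z (0 : N) = 0 :=
  (ℳ.tmulHom N z).map_zero

theorem smul_tmul {i j : ℤ} {a : A} {z : M} (ha : a ∈ 𝒜.gr i) (hz : z ∈ ℳ.gr j) (y : N) :
    ℳ.tmul (a • z) y = dgSign (i * j) • ℳ.tmul z (a • y) := by
  rw [← ℳ.tmul_balanced ha hz, zsmul_tmul, dgSign_smul_smul]

variable {ℳ} {𝒬}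

/-- The map `z ⊗ y ↦ φ z ⊗ y`, for `φ` of degree `e`. -/
theorem exists_tensorMap (φ : M →+ P) (e : ℤ)
    (hdeg : ∀ {j : ℤ} {z : M}, z ∈ ℳ.gr j → φ z ∈ 𝒬.gr (j + e))
    (hlin : ∀ {i : ℤ} {a : A} (z : M), a ∈ 𝒜.gr i → φ (a • z) = dgSign (i * e) • a • φ z)
    (N : Type x) [AddCommGroup N] [Module A N] :
    ∃ Φ : ℳ.TensorObj N →ₗ[ℤ] 𝒬.TensorObj N, ∀ z y, Φ (ℳ.tmul z y) = 𝒬.tmul (φ z) y := by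
  let T : M ⊗[ℤ] N →ₗ[ℤ] P ⊗[ℤ] N := TensorProduct.map φ.toIntLinearMap LinearMap.id
  have hT : ∀ z y, T (z ⊗ₜ[ℤ] y) = φ z ⊗ₜ[ℤ] y := fun _ _ => rfl
  have hrel : ℳ.tensorRel N ≤ (𝒬.tensorRel N).comap T := by
    refine Submodule.span_le.2 ?_
    rintro _ ⟨i, j, a, z, y, ha, hz, rfl⟩
    change T _ ∈ 𝒬.tensorRel N
    have := 𝒬.rel_mem ha (hdeg hz) y
    rwa [map_sub, hT, hT, map_zsmul, hlin z ha, smul_smul, ← dgSign_add, ← mul_add,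
      ← TensorProduct.smul_tmul']
  exact ⟨(ℳ.tensorRel N).mapQ (𝒬.tensorRel N) T hrel, fun z y => rfl⟩

theorem tensorMap_mem {φ : M →+ P} {e : ℤ}
    (hdeg : ∀ {j : ℤ} {z : M}, z ∈ ℳ.gr j → φ z ∈ 𝒬.gr (j + e))
    {Φ : ℳ.TensorObj N →ₗ[ℤ] 𝒬.TensorObj N} (hΦ : ∀ z y, Φ (ℳ.tmul z y) = 𝒬.tmul (φ z) y)
    {k : ℤ} {t : ℳ.TensorObj N} (ht : t ∈ ℳ.tensorGr 𝒩 k) : Φ t ∈ 𝒬.tensorGr 𝒩 (k + e) := by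
  induction ht using AddSubgroup.closure_induction with
  | mem t h =>
    obtain ⟨i, j, z, y, hz, hy, h, rfl⟩ := h
    rw [hΦ]
    exact 𝒬.tmul_mem 𝒩 (hdeg hz) hy (by lia)
  | zero => rw [map_zero]; exact zero_mem _
  | add s t _ _ h h' => rw [map_add]; exact add_mem h h'
  | neg t _ h => rw [map_neg]; exact neg_mem h

theorem exists_tensorMap_of_dgHom (f : DGHom ℳ 𝒬) :
    ∃ Φ : ℳ.TensorObj N →ₗ[ℤ] 𝒬.TensorObj N,
      (∀ z y, Φ (ℳ.tmul z y) = 𝒬.tmul (f.toFun z) y) ∧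
      (∀ {k : ℤ} {t : ℳ.TensorObj N}, t ∈ ℳ.tensorGr 𝒩 k → Φ t ∈ 𝒬.tensorGr 𝒩 k) ∧
      ∀ t, Φ (ℳ.tensorD 𝒩 t) = 𝒬.tensorD 𝒩 (Φ t) := by
  have hdeg : ∀ {j : ℤ} {z : M}, z ∈ ℳ.gr j → f.toFun.toAddMonoidHom z ∈ 𝒬.gr (j + 0) :=
    fun {j z} hz => by rw [add_zero]; exact f.map_mem hz
  obtain ⟨Φ, hΦ⟩ := exists_tensorMap (ℳ := ℳ) (𝒬 := 𝒬) f.toFun.toAddMonoidHom 0 hdeg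
    (fun {i a} z _ => by
      rw [mul_zero, show dgSign 0 = 1 from rfl, one_smul]; exact f.toFun.map_smul a z) N
  change ∀ z y, Φ (ℳ.tmul z y) = 𝒬.tmul (f.toFun z) y at hΦ
  refine ⟨Φ, hΦ, fun {k t} ht => ?_, fun t => ?_⟩
  · have := tensorMap_mem 𝒩 hdeg hΦ ht
    rwa [add_zero] at this
  · induction t using ℳ.tensor_induction 𝒩 with
    | zero => simp
    | add s t h h' => simp only [map_add, h, h']
    | tmul i j z y hz hy =>
      rw [ℳ.tensorD_tmul 𝒩 hz, map_add, map_zsmul, hΦ, hΦ, hΦ, 𝒬.tensorD_tmul 𝒩 (f.map_mem hz),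
        f.map_d]

/-- Exactness of the tensor product passes to homotopy retracts. -/
theorem _root_.DGHom.IsHomotopyToId.exactAt_tensor {q : DGHom ℳ 𝒬} {g : DGHom 𝒬 ℳ}
    {k : P →ₗ[A] P} (h : DGHom.IsHomotopyToId q g k) {i : ℤ}
    (hi : (ℳ.tensor 𝒩).ExactAt i) : (𝒬.tensor 𝒩).ExactAt i := by
  obtain ⟨Q, hQ, hQ', hQd⟩ := exists_tensorMap_of_dgHom 𝒩 q
  obtain ⟨G, hG, hG', hGd⟩ := exists_tensorMap_of_dgHom 𝒩 g
  -- The twist turns the `A`-linear `k` into a genuine homotopy of degree `1`, with `d κ + κ d = q g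
  -- - 1`.
  let κ : P →+ P := k.toAddMonoidHom.comp 𝒬.twist
  have hκ : ∀ {j : ℤ} {z : P}, z ∈ 𝒬.gr j → κ z = dgSign j • k z := fun {j z} hz => by
    change k (𝒬.twist z) = _
    rw [𝒬.twist_of_mem hz, map_zsmul]
  have hdeg : ∀ {j : ℤ} {z : P}, z ∈ 𝒬.gr j → κ z ∈ 𝒬.gr (j + 1) := fun {j z} hz => by
    rw [hκ hz]
    exact zsmul_mem (h.map_mem hz) _
  obtain ⟨K, hK⟩ := exists_tensorMap (ℳ := 𝒬) (𝒬 := 𝒬) κ 1 hdeg (fun {i a} z ha => by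
    induction z using 𝒬.toDGComplex.induction_on with
    | zero => simp
    | add s t h h' => simp only [smul_add, map_add, h, h']
    | hom j z hz =>
      rw [hκ (𝒬.smul_mem ha hz), hκ hz, map_smul k, mul_one, dgSign_add, mul_smul,
        smul_comm a (dgSign j)]) N
  have hKQ : ∀ t, 𝒬.tensorD 𝒩 (K t) + K (𝒬.tensorD 𝒩 t) = Q (G t) - t := by
    intro t
    induction t using 𝒬.tensor_induction 𝒩 with
    | zero => simp
    | add s t h h' =>
      simp only [map_add]
      rw [add_sub_add_comm, ← h, ← h']
      abel
    | tmul i j z y hz hy =>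
      rw [𝒬.tensorD_tmul 𝒩 hz, map_add, map_zsmul, hG, hQ, hK, hK, hK,
        𝒬.tensorD_tmul 𝒩 (hdeg hz), show dgSign (i + 1) = -dgSign i by
          rw [← neg_eq_iff_eq_neg, ← dgSign_sub_one, add_sub_cancel_right], neg_smul,
        add_add_add_comm, neg_add_cancel, add_zero, ← add_tmul, ← sub_tmul, hκ hz,
        hκ (𝒬.d_mem hz), map_zsmul, dgSign_sub_one, neg_smul, ← sub_eq_add_neg, ← smul_sub,
        h.map_d hz, dgSign_smul_smul]
  intro t ht hdt
  change 𝒬.tensorD 𝒩 t = 0 at hdt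
  obtain ⟨u, hu, hud⟩ := hi (G t) (hG' ht) (by
    change ℳ.tensorD 𝒩 (G t) = 0
    rw [← hGd, hdt, map_zero])
  change ℳ.tensorD 𝒩 u = G t at hud
  -- For a cycle `t` the homotopy gives `d (K t) = Q (G t) - t`, while `d (Q u) = Q (G t)`.
  refine ⟨Q u - K t, sub_mem (hQ' hu) (tensorMap_mem 𝒩 hdeg hK ht), ?_⟩
  change 𝒬.tensorD 𝒩 (Q u - K t) = t
  have := hKQ t
  rw [hdt, map_zero, add_zero] at this
  rw [map_sub, ← hQd, hud, this, sub_sub_cancel]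

end DGModule

/-! ### The filtration of the tensor product by degrees of basis elements. -/

namespace DGModule

variable {A : Type u} [Ring A] {𝒜 : DGAlgebra A}
  {M : Type v} [AddCommGroup M] [Module A M] {ℳ : DGModule 𝒜 M}
  {N : Type w} [AddCommGroup N] [Module A N] (𝒩 : DGModule 𝒜 N)
  {ι : Type x} (b : Module.Basis ι A M) {deg : ι → ℤ}

theorem repr_mem (hA : 𝒜.PositivelyGraded) (hb : ∀ j, b j ∈ ℳ.gr (deg j)) {p : ℤ} {z : M}
    (hz : z ∈ ℳ.gr p) (i : ι) : b.repr z i ∈ 𝒜.gr (p - deg i) := by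
  have hz' := mem_closure_of_mem_gr hA b hb hz
  clear hz
  induction hz' using AddSubgroup.closure_induction with
  | mem z hz =>
    obtain ⟨j, a, hj, ha, rfl⟩ := hz
    rw [map_smul, b.repr_self, Finsupp.smul_single, smul_eq_mul, mul_one]
    by_cases hij : j = i
    · subst hij
      rwa [Finsupp.single_eq_same]
    · rw [Finsupp.single_eq_of_ne (Ne.symm hij)]
      exact zero_mem _
  | zero => rw [map_zero]; exact zero_mem _
  | add s t _ _ h h' => rw [map_add]; exact add_mem h h'
  | neg t _ h => rw [map_neg]; exact neg_mem h

/-- The coordinate `z ⊗ y ↦ ± zᵢ y` of the tensor product with a free graded module. -/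
theorem exists_coord (hA : 𝒜.PositivelyGraded) (hb : ∀ j, b j ∈ ℳ.gr (deg j)) (i : ι)
    (N : Type w) [AddCommGroup N] [Module A N] :
    ∃ c : ℳ.TensorObj N →ₗ[ℤ] N, ∀ {p : ℤ} {z : M} (y : N), z ∈ ℳ.gr p →
      c (ℳ.tmul z y) = dgSign (p * deg i) • b.repr z i • y := by
  let f : M ⊗[ℤ] N →ₗ[ℤ] N := (TensorProduct.liftAddHom
    ((smulAddHom A N).comp (((b.coord i).toAddMonoidHom).comp (ℳ.twistBy (deg i))))
    (by intro r z y; rw [map_zsmul, map_zsmul]; rfl)).toIntLinearMap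
  have hf : ∀ {p : ℤ} {z : M} (y : N), z ∈ ℳ.gr p →
      f (z ⊗ₜ[ℤ] y) = dgSign (p * deg i) • b.repr z i • y := fun {p z} y hz => by
    change b.coord i (ℳ.twistBy (deg i) z) • y = _
    rw [ℳ.twistBy_of_mem _ hz, map_zsmul, smul_assoc]
    rfl
  refine ⟨(ℳ.tensorRel N).liftQ f (Submodule.span_le.2 ?_), fun y hz => hf y hz⟩
  rintro _ ⟨l, j, a, z, y, ha, hz, rfl⟩
  -- The coordinate of `a z` is `a zᵢ`, whereas `z ⊗ a y` produces `zᵢ a`; graded commutativity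
  -- exchanges the factors, and the exponents of the two signs then differ by `2 l j`.
  rw [SetLike.mem_coe, LinearMap.mem_ker, map_sub, sub_eq_zero, ← TensorProduct.smul_tmul',
    map_smul, hf y (ℳ.smul_mem ha hz), hf _ hz, map_smul, Finsupp.smul_apply, smul_eq_mul,
    ← mul_smul (b.repr z i) a y, 𝒜.graded_comm ha (repr_mem b hA hb hz i), smul_assoc,
    smul_smul, smul_smul, ← dgSign_add, ← dgSign_add]
  congr 1
  refine dgSign_congr ⟨l * j, by ring⟩

/-- The component of degree `k` of the submodule generated by the basis elements of degree at
most `p`, tensored with `𝒩`. -/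
def tensorFil (b : Module.Basis ι A M) (deg : ι → ℤ) (p k : ℤ) : AddSubgroup (ℳ.TensorObj N) :=
  AddSubgroup.closure {t | ∃ (j : ι) (y : N), deg j ≤ p ∧ y ∈ 𝒩.gr (k - deg j) ∧
    t = ℳ.tmul (b j) y}

theorem tensorFil_mono {p q : ℤ} (h : ∀ j, deg j ≤ p → deg j ≤ q) (k : ℤ) :
    tensorFil (ℳ := ℳ) 𝒩 b deg p k ≤ tensorFil 𝒩 b deg q k :=
  AddSubgroup.closure_mono fun _ ⟨j, y, hj, hy, h'⟩ => ⟨j, y, h j hj, hy, h'⟩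

variable {b}

/-- Expand `z` in basis elements of degree at most `p` and move the coefficients across the tensor
sign. -/
theorem tmul_mem_tensorFil (hA : 𝒜.PositivelyGraded) (hb : ∀ j, b j ∈ ℳ.gr (deg j))
    {p l k : ℤ} {z : M} (hz : z ∈ ℳ.gr p) {y : N} (hy : y ∈ 𝒩.gr l) (h : p + l = k) :
    ℳ.tmul z y ∈ tensorFil 𝒩 b deg p k := by
  have hz' := mem_closure_of_mem_gr hA b hb hz
  clear hz
  induction hz' using AddSubgroup.closure_induction with
  | mem z hz =>
    obtain ⟨j, a, hj, ha, rfl⟩ := hz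
    rw [ℳ.smul_tmul ha (hb j)]
    have hay := 𝒩.smul_mem ha hy
    rw [show p - deg j + l = k - deg j by lia] at hay
    have : ℳ.tmul (b j) (a • y) ∈ tensorFil 𝒩 b deg p k :=
      AddSubgroup.subset_closure ⟨j, a • y, hj, hay, rfl⟩
    exact zsmul_mem this _
  | zero => rw [zero_tmul]; exact zero_mem _
  | add s t _ _ h h' => rw [add_tmul]; exact add_mem h h'
  | neg t _ h => rw [neg_tmul]; exact neg_mem h

theorem tensorGr_le_tensorFil (hA : 𝒜.PositivelyGraded) (hb : ∀ j, b j ∈ ℳ.gr (deg j))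
    {q : ℤ} (hq : ∀ j, deg j ≤ q) (k : ℤ) : ℳ.tensorGr 𝒩 k ≤ tensorFil 𝒩 b deg q k := by
  refine (AddSubgroup.closure_le _).2 ?_
  rintro _ ⟨i, j, z, y, hz, hy, h, rfl⟩
  exact tensorFil_mono 𝒩 b (fun j _ => hq j) k (tmul_mem_tensorFil 𝒩 hA hb hz hy h)

theorem d_tmul_mem_tensorFil (hA : 𝒜.PositivelyGraded) (hb : ∀ j, b j ∈ ℳ.gr (deg j))
    {p k : ℤ} {j : ι} (hj : deg j ≤ p) {y : N} (hy : y ∈ 𝒩.gr (k + 1 - deg j)) :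
    ℳ.tmul (ℳ.d (b j)) y ∈ tensorFil 𝒩 b deg (p - 1) k :=
  tensorFil_mono 𝒩 b (fun i hi => by lia) k
    (tmul_mem_tensorFil 𝒩 hA hb (ℳ.d_mem (hb j)) hy (by lia))

theorem tensorD_mem_tensorFil (hA : 𝒜.PositivelyGraded) (hb : ∀ j, b j ∈ ℳ.gr (deg j))
    {p k : ℤ} {t : ℳ.TensorObj N} (ht : t ∈ tensorFil 𝒩 b deg p k) :
    ℳ.tensorD 𝒩 t ∈ tensorFil 𝒩 b deg p (k - 1) := by
  induction ht using AddSubgroup.closure_induction with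
  | mem t h =>
    obtain ⟨j, y, hj, hy, rfl⟩ := h
    rw [ℳ.tensorD_tmul 𝒩 (hb j)]
    have hdy := 𝒩.d_mem hy
    rw [sub_right_comm] at hdy
    have : ℳ.tmul (b j) (𝒩.d y) ∈ tensorFil 𝒩 b deg p (k - 1) :=
      AddSubgroup.subset_closure ⟨j, 𝒩.d y, hj, hdy, rfl⟩
    exact add_mem (tensorFil_mono 𝒩 b (fun i hi => by lia) _
      (d_tmul_mem_tensorFil 𝒩 hA hb hj (by rwa [sub_add_cancel]))) (zsmul_mem this _)
  | zero => rw [map_zero]; exact zero_mem _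
  | add s t _ _ h h' => rw [map_add]; exact add_mem h h'
  | neg t _ h => rw [map_neg]; exact neg_mem h

/-- The `i`-th coordinate recovers the coefficient of `b i` up to sign and ignores all lower layers,
so coefficients in the top layer can be compared. -/
theorem exists_coord_tensorFil (hA : 𝒜.PositivelyGraded) (hb : ∀ j, b j ∈ ℳ.gr (deg j)) (i : ι) :
    ∃ c : ℳ.TensorObj N →ₗ[ℤ] N, (∀ y, c (ℳ.tmul (b i) y) = dgSign (deg i * deg i) • y) ∧
      (∀ j ≠ i, ∀ y, c (ℳ.tmul (b j) y) = 0) ∧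
      ∀ {p k : ℤ} {t : ℳ.TensorObj N}, p < deg i → t ∈ tensorFil 𝒩 b deg p k → c t = 0 := by
  obtain ⟨c, hc⟩ := exists_coord (ℳ := ℳ) b hA hb i N
  have hne : ∀ j ≠ i, ∀ y, c (ℳ.tmul (b j) y) = 0 := fun j hj y => by
    rw [hc y (hb j), b.repr_self, Finsupp.single_eq_of_ne (Ne.symm hj), zero_smul, smul_zero]
  refine ⟨c, fun y => ?_, hne, fun {p k t} hp ht => ?_⟩
  · rw [hc y (hb i), b.repr_self, Finsupp.single_eq_same, one_smul]
  · induction ht using AddSubgroup.closure_induction with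
    | mem t h =>
      obtain ⟨j, y, hj, hy, rfl⟩ := h
      exact hne j (by rintro rfl; lia) y
    | zero => exact map_zero _
    | add s t _ _ h h' => rw [map_add, h, h', add_zero]
    | neg t _ h => rw [map_neg, h, neg_zero]

/-- The finitely supported `f` records the leading part of `t`, carried by the basis elements of
degree exactly `p`. -/
theorem exists_sum_sub_mem_tensorFil {p k : ℤ} {t : ℳ.TensorObj N}
    (ht : t ∈ tensorFil 𝒩 b deg p k) :
    ∃ f : ι →₀ N, (∀ j, f j ∈ 𝒩.gr (k - p)) ∧ (∀ j, deg j ≠ p → f j = 0) ∧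
      t - f.sum (fun j y => ℳ.tmul (b j) y) ∈ tensorFil 𝒩 b deg (p - 1) k := by
  classical
  induction ht using AddSubgroup.closure_induction with
  | mem t h =>
    obtain ⟨j, y, hj, hy, rfl⟩ := h
    by_cases hjp : deg j = p
    · refine ⟨Finsupp.single j y, fun i => ?_, fun i hi => ?_, ?_⟩
      · rw [Finsupp.single_apply]
        split_ifs
        · rwa [← hjp]
        · exact zero_mem _
      · exact Finsupp.single_eq_of_ne (by rintro rfl; exact hi hjp)
      · rw [Finsupp.sum_single_index (h := fun j y => ℳ.tmul (b j) y) (ℳ.tmul_zero _), sub_self]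
        exact zero_mem _
    · refine ⟨0, fun i => zero_mem _, fun i _ => rfl, ?_⟩
      rw [Finsupp.sum_zero_index, sub_zero]
      exact AddSubgroup.subset_closure ⟨j, y, by lia, hy, rfl⟩
  | zero => exact ⟨0, fun i => zero_mem _, fun i _ => rfl, by simp⟩
  | add s t _ _ h h' =>
    obtain ⟨f, hf1, hf2, hf3⟩ := h
    obtain ⟨g, hg1, hg2, hg3⟩ := h'
    refine ⟨f + g, fun i => add_mem (hf1 i) (hg1 i), fun i hi => ?_, ?_⟩
    · rw [Finsupp.add_apply, hf2 i hi, hg2 i hi, add_zero]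
    · rw [Finsupp.sum_add_index' (h := fun j y => ℳ.tmul (b j) y)
        (fun _ => ℳ.tmul_zero _) (fun _ => ℳ.tmul_add _),
        add_sub_add_comm]
      exact add_mem hf3 hg3
  | neg t _ h =>
    obtain ⟨f, hf1, hf2, hf3⟩ := h
    refine ⟨-f, fun i => neg_mem (hf1 i), fun i hi => ?_, ?_⟩
    · rw [Finsupp.neg_apply, hf2 i hi, neg_zero]
    · have : (-f).sum (fun j y => ℳ.tmul (b j) y) = -f.sum (fun j y => ℳ.tmul (b j) y) := by
        rw [Finsupp.sum_neg_index (h := fun j y => ℳ.tmul (b j) y)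
          (fun _ => ℳ.tmul_zero _), Finsupp.sum, Finsupp.sum, ← Finset.sum_neg_distrib]
        exact Finset.sum_congr rfl fun j _ => map_neg (ℳ.tmulHom N (b j)) (f j)
      rw [this, ← neg_sub', neg_mem_iff]
      exact hf3

/-- A cycle can be moved one step down in the filtration by adding a boundary. -/
theorem exists_sub_tensorD_mem_tensorFil (hA : 𝒜.PositivelyGraded)
    (hb : ∀ j, b j ∈ ℳ.gr (deg j)) {k : ℤ} (hN : ∀ j, 𝒩.ExactAt (k - deg j)) {p : ℤ}
    {t : ℳ.TensorObj N} (ht : t ∈ tensorFil 𝒩 b deg p k) (hdt : ℳ.tensorD 𝒩 t = 0) :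
    ∃ u ∈ ℳ.tensorGr 𝒩 (k + 1), t - ℳ.tensorD 𝒩 u ∈ tensorFil 𝒩 b deg (p - 1) k := by
  classical
  obtain ⟨f, hf, hf0, hft⟩ := exists_sum_sub_mem_tensorFil 𝒩 ht
  have hdeg : ∀ j ∈ f.support, deg j = p := fun j hj => by
    by_contra h
    exact Finsupp.mem_support_iff.1 hj (hf0 j h)
  -- Modulo lower layers, `0 = d t` is the sum of the `± b j ⊗ d (f j)`; the `i`-th coordinate
  -- isolates `d (f i)`.
  have hd0 : ∀ i ∈ f.support, 𝒩.d (f i) = 0 := by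
    intro i hi
    obtain ⟨c, hci, hcj, hcp⟩ := exists_coord_tensorFil 𝒩 hA hb i
    have h1 := hcp (by have := hdeg i hi; lia) (tensorD_mem_tensorFil 𝒩 hA hb hft)
    rw [map_sub, hdt, zero_sub, map_neg, neg_eq_zero, Finsupp.sum, map_sum, map_sum,
      Finset.sum_eq_single_of_mem i hi] at h1
    · rw [ℳ.tensorD_tmul 𝒩 (hb i), map_add, map_zsmul, hci,
        hcp (by lia) (d_tmul_mem_tensorFil 𝒩 hA hb (k := k - 1) (le_refl (deg i))
          (by rw [sub_add_cancel, hdeg i hi]; exact hf i)), zero_add, smul_smul,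
        ← dgSign_add] at h1
      have h2 := congrArg (fun y => dgSign (deg i + deg i * deg i) • y) h1
      simpa only [dgSign_smul_smul, smul_zero] using h2
    · intro j hj hji
      rw [ℳ.tensorD_tmul 𝒩 (hb j), map_add, map_zsmul, hcj j hji, smul_zero, add_zero]
      exact hcp (by rw [hdeg i hi, ← hdeg j hj]; lia)
        (d_tmul_mem_tensorFil 𝒩 hA hb (k := k - 1) (le_refl (deg j))
          (by rw [sub_add_cancel, hdeg j hj]; exact hf j))
  have hv : ∀ j : ι, ∃ v : N, j ∈ f.support → v ∈ 𝒩.gr (k - deg j + 1) ∧ 𝒩.d v = f j := by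
    intro j
    by_cases hj : j ∈ f.support
    · obtain ⟨v, hv, hv'⟩ := hN j (f j) (by rw [hdeg j hj]; exact hf j) (hd0 j hj)
      exact ⟨v, fun _ => ⟨hv, hv'⟩⟩
    · exact ⟨0, fun h => absurd h hj⟩
  choose v hv using hv
  -- The signs cancel those in the Leibniz rule: the boundary of this sum is the leading part of `t`
  -- plus terms `± d (b j) ⊗ v j` of lower filtration.
  refine ⟨∑ j ∈ f.support, dgSign (deg j) • ℳ.tmul (b j) (v j), AddSubgroup.sum_mem _
    fun j hj => zsmul_mem (ℳ.tmul_mem 𝒩 (hb j) (hv j hj).1 (by lia)) _, ?_⟩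
  have h1 : ℳ.tensorD 𝒩 (∑ j ∈ f.support, dgSign (deg j) • ℳ.tmul (b j) (v j)) =
      ∑ j ∈ f.support, dgSign (deg j) • ℳ.tmul (ℳ.d (b j)) (v j) +
        f.sum (fun j y => ℳ.tmul (b j) y) := by
    rw [map_sum, Finsupp.sum, ← Finset.sum_add_distrib]
    refine Finset.sum_congr rfl fun j hj => ?_
    rw [map_smul, ℳ.tensorD_tmul 𝒩 (hb j), smul_add, dgSign_smul_smul, (hv j hj).2]
  rw [h1, sub_add_eq_sub_sub_swap]
  refine sub_mem hft (AddSubgroup.sum_mem _ fun j hj => zsmul_mem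
    (d_tmul_mem_tensorFil 𝒩 hA hb (hdeg j hj).le ?_) _)
  have := (hv j hj).1
  rwa [show k - deg j + 1 = k + 1 - deg j by ring] at this

/-- If `ℳ` is free on basis elements in a bounded range of degrees, then `H_k(ℳ ⊗ 𝒩)` vanishes
as soon as all the groups `H_{k - |b|}(𝒩)`, for basis elements `b`, do. -/
theorem exactAt_tensor_of_basis (hA : 𝒜.PositivelyGraded) (hb : ∀ j, b j ∈ ℳ.gr (deg j))
    {l q : ℤ} (hl : ∀ j, l ≤ deg j) (hq : ∀ j, deg j ≤ q) {k : ℤ}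
    (hN : ∀ j, 𝒩.ExactAt (k - deg j)) : (ℳ.tensor 𝒩).ExactAt k := by
  -- The induction starts at level `l - 1`, where the filtration is zero because no basis element
  -- has degree below `l`.
  have key : ∀ (r : ℕ) (t : ℳ.TensorObj N), t ∈ tensorFil 𝒩 b deg (l - 1 + r) k →
      ℳ.tensorD 𝒩 t = 0 → ∃ u ∈ ℳ.tensorGr 𝒩 (k + 1), ℳ.tensorD 𝒩 u = t := by
    intro r
    induction r with
    | zero =>
      intro t ht _
      refine ⟨0, zero_mem _, ?_⟩
      have hbot : tensorFil (ℳ := ℳ) 𝒩 b deg (l - 1 + (0 : ℕ)) k ≤ ⊥ := by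
        refine (AddSubgroup.closure_le _).2 ?_
        rintro _ ⟨j, y, hj, -, -⟩
        have := hl j
        lia
      rw [map_zero, AddSubgroup.mem_bot.1 (hbot ht)]
    | succ r ih =>
      intro t ht hdt
      obtain ⟨u, hu, hu'⟩ := exists_sub_tensorD_mem_tensorFil 𝒩 hA hb hN ht hdt
      obtain ⟨u', hu1, hu2⟩ := ih _
        (by rwa [show l - 1 + ((r + 1 : ℕ) : ℤ) - 1 = l - 1 + (r : ℤ) by lia] at hu')
        (by rw [map_sub, hdt, ℳ.tensorD_tensorD, sub_zero])
      exact ⟨u + u', add_mem hu hu1, by rw [map_add, hu2, add_sub_cancel]⟩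
  intro t ht hdt
  have h1 : ∀ j, deg j ≤ l - 1 + ((q - (l - 1)).toNat : ℤ) := fun j => by
    have := hq j
    lia
  exact key _ t (tensorGr_le_tensorFil 𝒩 hA hb h1 k ht) hdt

end DGModule

/-! ### Supremum, infimum and amplitude in the extended reals. -/

namespace DGComplex

variable {M : Type u} [AddCommGroup M] (C : DGComplex M)

theorem infH_le {i : ℤ} (h : Nontrivial (C.Homology i)) : C.infH ≤ ((i : ℝ) : EReal) :=
  sInf_le (Set.mem_image_of_mem _ h)

theorem le_supH {i : ℤ} (h : Nontrivial (C.Homology i)) : ((i : ℝ) : EReal) ≤ C.supH :=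
  le_sSup (Set.mem_image_of_mem _ h)

end DGComplex

theorem EReal.add_sub_add_le_of_sub_lt_top {a b : EReal} (h : a - b < ⊤) (x y : ℝ) :
    a + x + y - (b + x) ≤ a - b + y := by
  induction a <;> induction b <;> try simp_all
  norm_cast
  linarith

/-! ### Comparison of a semifree module with its semifree resolutions, and the bounds. -/

namespace DGModule

variable {A : Type u} [Ring A] {𝒜 : DGAlgebra A}
  {M : Type v} [AddCommGroup M] [Module A M] {ℳ : DGModule 𝒜 M}
  {N : Type w} [AddCommGroup N] [Module A N] (𝒩 : DGModule 𝒜 N)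

/-- Over a nonzero ring basis elements are nonzero, so they cannot lie in the vanishing components
of low degree. -/
theorem IsSemifree.exists_basis [Nontrivial A] (h : ℳ.IsSemifree) :
    ∃ (B : Set M) (b : Module.Basis B A M) (deg : B → ℤ) (l : ℤ),
      (∀ j, b j ∈ ℳ.gr (deg j)) ∧ ∀ j, l ≤ deg j := by
  obtain ⟨⟨l, hl⟩, B, hB⟩ := h
  obtain ⟨b, hb⟩ := hB.exists_basis
  choose deg hdeg using fun j : B => hB.homogeneous j j.2
  refine ⟨B, b, deg, l, fun j => by rw [hb]; exact hdeg j, fun j => ?_⟩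
  by_contra! hj
  have := hdeg j
  rw [hl _ hj, AddSubgroup.mem_bot, ← hb] at this
  exact b.ne_zero j this

/-- Over a positively graded DG algebra, exactness of `ℳ ⊗ 𝒩` for a semifree `ℳ` passes to
`F ⊗ 𝒩` for every semifree resolution `F` of `ℳ`. -/
theorem SemifreeResolution.exactAt_derivedTensor [Nontrivial A] (hA : 𝒜.PositivelyGraded)
    (hM : ℳ.IsSemifree) (r : SemifreeResolution.{u, v, x} ℳ) {k : ℤ}
    (hk : (ℳ.tensor 𝒩).ExactAt k) : (r.derivedTensor 𝒩).ExactAt k := by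
  obtain ⟨_, b, _, _, hb, hl⟩ := hM.exists_basis
  obtain ⟨_, b', _, _, hb', hl'⟩ := r.isSemifree.exists_basis
  have hinj := r.isQuasiIso.reflectsBoundaries
  obtain ⟨g, h, hg⟩ := exists_homotopyToId b hA hb hl r.hom hinj r.isQuasiIso.liftsCycles
  -- The right inverse `g : ℳ → F` is again bijective on homology and its target is semifree, so it
  -- has a right inverse `f` up to homotopy. Thus `g f` is homotopic to the identity of `F`, which
  -- is the retraction needed.
  obtain ⟨f, h', hf⟩ := exists_homotopyToId b' hA hb' hl' g hg.reflectsBoundaries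
    (hg.liftsCycles hinj)
  exact hf.exactAt_tensor 𝒩 hk

end DGModule

theorem proposition3p4
    {A : Type u} [Ring A] (𝒜 : DGAlgebra A) (hA : 𝒜.PositivelyGraded)
    (s : ℤ) (hs : 𝒜.ampH = ((s : ℝ) : EReal))
    {L : Type v} [AddCommGroup L] [Module A L] [Nontrivial L] (ℒ : DGModule 𝒜 L)
    (hL : ℒ.IsSemifree) (n m : ℤ) (hm : 0 ≤ m)
    (B : Set L) (hB : ℒ.IsSemibasis B)
    (hdeg : ∀ b ∈ B, ∃ i : ℤ, n ≤ i ∧ i ≤ n + m ∧ b ∈ ℒ.gr i)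
    {Y : Type w} [AddCommGroup Y] [Module A Y] (𝒴 : DGModule 𝒜 Y)
    (hY : 𝒴.HomologicallyBounded)
    (r : DGModule.SemifreeResolution.{u, v, x} ℒ) :
    𝒴.infH + ((n : ℝ) : EReal) ≤ (r.derivedTensor 𝒴).infH ∧
      (r.derivedTensor 𝒴).supH ≤ 𝒴.supH + ((n : ℝ) : EReal) + ((m : ℝ) : EReal) ∧
      (r.derivedTensor 𝒴).ampH ≤ 𝒴.ampH + ((m : ℝ) : EReal) := by
  have : Nontrivial A := Module.nontrivial A L
  obtain ⟨b, hb⟩ := hB.exists_basis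
  choose deg hn hnm hmem using fun j : B => hdeg j j.2
  have hb' : ∀ j, b j ∈ ℒ.gr (deg j) := fun j => by rw [hb]; exact hmem j
  -- Otherwise `Y` is exact in all degrees `k - deg j`, and then so are `L ⊗ Y` and `F ⊗ Y` in
  -- degree `k`.
  have key : ∀ k : ℤ, Nontrivial ((r.derivedTensor 𝒴).Homology k) →
      ∃ j : ℤ, n ≤ j ∧ j ≤ n + m ∧ Nontrivial (𝒴.Homology (k - j)) := by
    intro k hk
    by_contra! h
    refine (DGComplex.exactAt_iff _ k).1 (r.exactAt_derivedTensor 𝒴 hA hL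
      (DGModule.exactAt_tensor_of_basis 𝒴 hA hb' hn hnm fun j => ?_)) hk
    exact (DGComplex.exactAt_iff _ _).2
      (not_nontrivial_iff_subsingleton.2 (h _ (hn j) (hnm j)))
  have hinf : 𝒴.infH + ((n : ℝ) : EReal) ≤ (r.derivedTensor 𝒴).infH := by
    refine le_sInf ?_
    rintro _ ⟨k, hk, rfl⟩
    obtain ⟨j, hj, -, hkj⟩ := key k hk
    calc 𝒴.infH + ((n : ℝ) : EReal) ≤ (((k - j : ℤ) : ℝ) : EReal) + ((n : ℝ) : EReal) :=
          add_le_add_left (𝒴.infH_le hkj) _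
      _ ≤ ((k : ℝ) : EReal) := by
          rw [← EReal.coe_add, EReal.coe_le_coe_iff]
          exact_mod_cast (by lia : k - j + n ≤ k)
  have hsup : (r.derivedTensor 𝒴).supH ≤ 𝒴.supH + ((n : ℝ) : EReal) + ((m : ℝ) : EReal) := by
    refine sSup_le ?_
    rintro _ ⟨k, hk, rfl⟩
    obtain ⟨j, -, hj, hkj⟩ := key k hk
    calc ((k : ℝ) : EReal)
        ≤ (((k - j : ℤ) : ℝ) : EReal) + ((n : ℝ) : EReal) + ((m : ℝ) : EReal) := by
          rw [← EReal.coe_add, ← EReal.coe_add, EReal.coe_le_coe_iff]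
          exact_mod_cast (by lia : k ≤ k - j + n + m)
      _ ≤ 𝒴.supH + ((n : ℝ) : EReal) + ((m : ℝ) : EReal) :=
          add_le_add_left (add_le_add_left (𝒴.le_supH hkj) _) _
  exact ⟨hinf, hsup, (EReal.sub_le_sub hsup hinf).trans
    (EReal.add_sub_add_le_of_sub_lt_top hY n m)⟩
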